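/- Conventions. A lattice $L$ is a finitely generated $\mathbb{Z}$-submodule spanning a finite-dimensional quadratic space $(V,Q)$ over $\mathbb{Q}$; $B$ is the symmetric bilinear form with $Q(v)=B(v,v)$, and $L\cong\langle a_1,\dots,a_n\rangle$ means that $L$ has a $\mathbb{Z}$-basis whose Gram matrix with respect to $B$ is $\operatorname{diag}(a_1,\dots,a_n)$. The scale of $L$ is the $\mathbb{Z}$-module generated by all $B(x,y)$, $x,y\in L$. $L$ is positive definite if $Q(v)>0$ for all $0\neq v\in L$; put $Q(L)=\{Q(v):v\in L\}$ and let $\mathcal{E}(L)$ be the set of positive integers not in $Q(L)$. The genus $\operatorname{gen}L$ is the set of all lattices $K$ on $V$ such that for every prime $p$ some isometry of $\mathbb{Q}_p\otimes V$ carries $L_p$ onto $K_p$, where $L_p$ is the $\mathbb{Z}_p$-submodule generated by $L$. A positive definite lattice $L$ is regular if $Q(L)=\{a\in\mathbb{Z}: a\in Q(K)\text{ for some }K\in\operatorname{gen}L\}$. For positive integers $a<m$ let $\mathcal{A}_{a,m}=\{a+mx : x=0,1,2,\dots\}$; it is admissible if $\operatorname{ord}_p a<\operatorname{ord}_p m$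 for every prime $p\mid m$. A positive definite lattice $L$ avoids exactly $k$ arithmetic progressions if $\mathcal{E}(L)$ is a union of $k$ admissible arithmetic progressions but is not a union of fewer than $k$ admissible arithmetic progressions. Proposition 3. (i) For every integer $r\ge 1$, every lattice $L(r)\cong\langle 1,3,9,9^r\rangle$ is positive definite and regular, $$\mathcal{E}(L(r))=\mathcal{A}_{2,3}\cup\bigcup_{i=1}^{r}\mathcal{A}_{2\cdot 3^{2i-1},\,3^{2i}},$$ all $r+1$ progressions on the right are admissible, and $\mathcal{E}(L(r))$ is not a union of fewer than $r+1$ admissible arithmetic progressions. So $L(r)$ avoids exactly $r+1$ arithmetic progressions. (ii) For every integer $k\ge 1$ there is a positive definite diagonal quaternary lattice $L\cong\langle a,b,c,d\rangle$ with $a,b,c,d\in\mathbb{Z}$, of scale $\mathbb{Z}$, that avoids exactly $k$ arithmetic progressions. -/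

import Mathlib

open scoped TensorProduct

noncomputable section

namespace QuadLattice

/-- The arithmetic progression `{a + m x : x = 0, 1, 2, …}`. -/
def progression (a m : ℕ) : Set ℕ := {n | ∃ x : ℕ, n = a + m * x}

/-- The progression with first term `a` and difference `m` is admissible: `0 < a < m`, and
`ord_p a < ord_p m` for every prime `p` dividing `m`. -/
def IsAdmissible (a m : ℕ) : Prop :=
  0 < a ∧ a < m ∧ ∀ p : ℕ, p.Prime → p ∣ m → padicValNat p a < padicValNat p m

/-- `S` is a union of `k` admissible arithmetic progressions. -/
def IsUnionOfAdmissible (S : Set ℕ) (k : ℕ) : Prop :=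
  ∃ a m : Fin k → ℕ, (∀ i, IsAdmissible (a i) (m i)) ∧ S = ⋃ i, progression (a i) (m i)

section Lattice

variable {V : Type*} [AddCommGroup V] [Module ℚ V]

/-- The symmetric bilinear form `B` with `Q v = B (v, v)`. -/
abbrev bilin (Q : QuadraticForm ℚ V) : LinearMap.BilinForm ℚ V := QuadraticMap.associated Q

/-- The scale of `L`: the `ℤ`-submodule of `ℚ` generated by the values `B (x, y)`, `x, y ∈ L`. -/
def scale (Q : QuadraticForm ℚ V) (L : Submodule ℤ V) : Submodule ℤ ℚ :=
  Submodule.span ℤ {c | ∃ x ∈ L, ∃ y ∈ L, c = bilin Q x y}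

/-- `L ≅ ⟨a₁, …, aₙ⟩`: some `ℤ`-basis of `L` has the Gram matrix `diag (a₁, …, aₙ)`. -/
def IsDiagonal (Q : QuadraticForm ℚ V) (L : Submodule ℤ V) {n : ℕ} (a : Fin n → ℤ) : Prop :=
  ∃ b : Module.Basis (Fin n) ℤ L,
    (Matrix.of fun i j => bilin Q (b i : V) (b j : V)) = Matrix.diagonal fun i => (a i : ℚ)

/-- `L` is positive definite. -/
def IsPosDef (Q : QuadraticForm ℚ V) (L : Submodule ℤ V) : Prop :=
  ∀ v ∈ L, v ≠ 0 → 0 < Q v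

/-- The represented value set `Q(L)`. -/
def valueSet (Q : QuadraticForm ℚ V) (L : Submodule ℤ V) : Set ℚ := {c | ∃ v ∈ L, Q v = c}

/-- The excluded set: the positive integers that are not represented by `L`. -/
def excluded (Q : QuadraticForm ℚ V) (L : Submodule ℤ V) : Set ℕ :=
  {n | 0 < n ∧ (n : ℚ) ∉ valueSet Q L}

/-- The localization `L_p`: the `ℤ_p`-submodule of `V_p = ℚ_p ⊗ V` generated by `L`. -/
def localization (p : ℕ) [Fact p.Prime] (L : Submodule ℤ V) :
    Submodule ℤ_[p] (ℚ_[p] ⊗[ℚ] V) :=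
  Submodule.span ℤ_[p] ((fun v : V => (1 : ℚ_[p]) ⊗ₜ[ℚ] v) '' (L : Set V))

/-- The genus of `L`: the lattices `K` on the quadratic space of `L` such that for every prime `p`
some isometry of `V_p` onto itself carries `L_p` onto `K_p`. -/
def genus (Q : QuadraticForm ℚ V) (L : Submodule ℤ V) : Set (Submodule ℤ V) :=
  {K | Submodule.IsLattice ℚ K ∧ ∀ (p : ℕ) [Fact p.Prime],
    ∃ σ : (Q.baseChange ℚ_[p]).IsometryEquiv (Q.baseChange ℚ_[p]),
      σ '' (localization p L : Set (ℚ_[p] ⊗[ℚ] V)) = localization p K}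

/-- The set `Q(gen L)` of the integers represented by some lattice in the genus of `L`. -/
def genusValueSet (Q : QuadraticForm ℚ V) (L : Submodule ℤ V) : Set ℚ :=
  {c | (∃ n : ℤ, c = n) ∧ ∃ K ∈ genus Q L, c ∈ valueSet Q K}

/-- A positive definite lattice `L` is regular if `Q(L) = Q(gen L)`. -/
def IsRegular (Q : QuadraticForm ℚ V) (L : Submodule ℤ V) : Prop :=
  IsPosDef Q L ∧ valueSet Q L = genusValueSet Q L

/-- The positive definite lattice `L` avoids exactly `k` arithmetic progressions. -/
def AvoidsExactly (Q : QuadraticForm ℚ V) (L : Submodule ℤ V) (k : ℕ) : Prop :=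
  IsPosDef Q L ∧ IsUnionOfAdmissible (excluded Q L) k ∧
    ∀ t : ℕ, t < k → ¬ IsUnionOfAdmissible (excluded Q L) t

end Lattice

end QuadLattice

end

/-! Everything rests on the ternary form x² + y² + 3z², which represents every positive integer that
is prime to 3 or ≡ 3 mod 9. Given such an n, Dirichlet's theorem supplies a prime p ≡ 5 mod 8 for
which n and p are both diagonal entries of a positive ternary Gram matrix of determinant 3.
Reduction leaves only x² + y² + 3z² and x² + 2(y² ± yz + z²) as candidates, and the latter never
takes a value ≡ 5 mod 8.

The remaining multiples of 3 are ≡ 6 or 0 mod 9. For the quaternary forms the latter are handled by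
descent through division by 9. Conversely, x² + y² + 3z² misses 6 mod 9 and is ≡ 0 mod 9 only if 3
divides x, y and z, so each `9 ^ j * (9 * q + 6)` with `j < r` is excluded already modulo 9^r. The
obstructions are thus purely 3-adic, which gives regularity.

Minimality of the number of progressions (`not_isUnionOfAdmissible`): an admissible progression of
difference m has constant 3-adic order if 3 ∣ m, and otherwise meets every class mod 3. The excluded
set avoids 1 mod 3 and contains elements of `r + 1` different orders. The case k = 1 of the second
part needs another lattice, ⟨1, 1, 3, 9⟩. -/

namespace QuadLattice

/-! ### Reduction of positive ternary forms of determinant 3 -/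

/-- The value at `(x, y, z)` of the ternary form with diagonal `a, b, c` and off-diagonal Gram
entries `d = B(e₁, e₂)`, `e = B(e₁, e₃)`, `f = B(e₂, e₃)`. -/
def ternary (a b c d e f x y z : ℤ) : ℤ :=
  a * x ^ 2 + b * y ^ 2 + c * z ^ 2 + 2 * d * (x * y) + 2 * e * (x * z) + 2 * f * (y * z)

lemma exists_two_mul_add_mul_abs_le (m k : ℤ) (hm : 0 < m) : ∃ t : ℤ, 2 * |k + t * m| ≤ m := by
  refine ⟨-((2 * k + m) / (2 * m)), ?_⟩
  have h1 := Int.emod_add_mul_ediv (2 * k + m) (2 * m)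
  have h2 := Int.emod_nonneg (2 * k + m) (b := 2 * m) (by omega)
  have h3 := Int.emod_lt_of_pos (2 * k + m) (b := 2 * m) (by omega)
  set q := (2 * k + m) / (2 * m)
  have h4 : 2 * m * q = 2 * (q * m) := by ring
  rw [h4] at h1
  have h5 : -q * m = -(q * m) := by ring
  rw [h5]
  rcases abs_cases (k + -(q * m)) with ⟨h, _⟩ | ⟨h, _⟩ <;> rw [h] <;> omega

/-- The end of the reduction: b = 1 gives ⟨1, 1, 3⟩, while b = 2 forces f = ±1, c = 2, a form that
misses 5 mod 8. -/
lemma exists_sq_add_sq_add_three_mul_sq_of_reduced {b c f : ℤ} (hb : 0 < b)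
    (hdet : b * c - f ^ 2 = 3) (hf : 2 * |f| ≤ b) (hbb : b ^ 2 ≤ 4)
    (h5 : ∃ x y z, ternary 1 b c 0 0 f x y z % 8 = 5) (x y z : ℤ) :
    ∃ X Y Z : ℤ, ternary 1 b c 0 0 f x y z = X ^ 2 + Y ^ 2 + 3 * Z ^ 2 := by
  have hb2 : b ≤ 2 := by nlinarith
  have hf1 := neg_abs_le f
  have hf2 := le_abs_self f
  obtain rfl | rfl : b = 1 ∨ b = 2 := by omega
  · obtain rfl : f = 0 := by omega
    obtain rfl : c = 3 := by linarith
    exact ⟨x, y, z, by simp [ternary]⟩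
  · exfalso
    obtain ⟨x, y, z, h⟩ := h5
    have key : ∀ f : ℤ, f = 1 ∨ f = -1 → ∀ x y z : ZMod 8,
        x ^ 2 + 2 * y ^ 2 + 2 * z ^ 2 + 2 * (f : ZMod 8) * (y * z) ≠ 5 := by
      rintro f (rfl | rfl)
      · decide
      · decide
    have hf3 : f = -1 ∨ f = 0 ∨ f = 1 := by omega
    have hc : f ≠ 0 := by rintro rfl; omega
    have hf4 : f = 1 ∨ f = -1 := by omega
    have hc2 : c = 2 := by rcases hf4 with rfl | rfl <;> linarith
    subst hc2
    apply key f hf4 x y z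
    have h' : ternary 1 2 2 0 0 f x y z ≡ 5 [ZMOD 8] := h
    have := (ZMod.intCast_eq_intCast_iff _ _ 8).2 h'
    simpa [ternary] using this

/-- A positive definite ternary form of determinant `3` which represents some integer congruent to
`5` modulo `8` represents only integers of the form `X² + Y² + 3 Z²`. -/
theorem exists_sq_add_sq_add_three_mul_sq_of_det_eq_three (N M : ℕ) :
    ∀ a b c d e f : ℤ, a.toNat = N → (a * b - d ^ 2).toNat = M → 0 < a → 0 < a * b - d ^ 2 →
      a * b * c + 2 * d * e * f - a * f ^ 2 - b * e ^ 2 - c * d ^ 2 = 3 →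
      (∃ x y z, ternary a b c d e f x y z % 8 = 5) →
      ∀ x y z, ∃ X Y Z : ℤ, ternary a b c d e f x y z = X ^ 2 + Y ^ 2 + 3 * Z ^ 2 := by
  -- Lexicographic descent on (a, A), where A = ab - d² is the leading 2 × 2 minor.
  induction N using Nat.strong_induction_on generalizing M with
  | _ N ihN =>
  induction M using Nat.strong_induction_on with
  | _ M ihM =>
  intro a b c d e f hN hM ha hA hdet h5 x y z
  -- shift the third basis vector by a multiple of the second
  obtain ⟨t, ht⟩ := exists_two_mul_add_mul_abs_le _ (a * f - d * e) hA
  obtain ⟨c₁, hc₁⟩ : ∃ c₁, c₁ = c + 2 * t * f + t ^ 2 * b := ⟨_, rfl⟩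
  obtain ⟨e₁, he₁⟩ : ∃ e₁, e₁ = e + t * d := ⟨_, rfl⟩
  obtain ⟨f₁, hf₁⟩ : ∃ f₁, f₁ = f + t * b := ⟨_, rfl⟩
  have sub₁ : ∀ x y z, ternary a b c d e f x y z = ternary a b c₁ d e₁ f₁ x (y - t * z) z := by
    intro x y z; simp only [ternary, hc₁, he₁, hf₁]; ring
  have hdet₁ : a * b * c₁ + 2 * d * e₁ * f₁ - a * f₁ ^ 2 - b * e₁ ^ 2 - c₁ * d ^ 2 = 3 := by
    rw [← hdet, hc₁, he₁, hf₁]; ring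
  have ht₁ : 2 * |a * f₁ - d * e₁| ≤ a * b - d ^ 2 := by
    convert ht using 3; rw [he₁, hf₁]; ring
  have hAC : (a * b - d ^ 2) * (a * c₁ - e₁ ^ 2) = 3 * a + (a * f₁ - d * e₁) ^ 2 := by
    rw [← hdet₁]; ring
  have hC : 0 < a * c₁ - e₁ ^ 2 := by
    by_contra hneg
    have := mul_nonneg hA.le (by linarith : 0 ≤ -(a * c₁ - e₁ ^ 2))
    nlinarith [sq_nonneg (a * f₁ - d * e₁)]
  have h5₁ : ∃ x y z, ternary a b c₁ d e₁ f₁ x y z % 8 = 5 := by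
    obtain ⟨x, y, z, h⟩ := h5
    exact ⟨_, _, _, sub₁ x y z ▸ h⟩
  rw [sub₁]
  generalize y - t * z = y
  clear sub₁ hc₁ he₁ hf₁ ht h5 hdet
  -- With C = ac₁ - e₁², exchanging the last two basis vectors replaces A by C and keeps a.
  by_cases hCA : a * c₁ - e₁ ^ 2 < a * b - d ^ 2
  · have swap : ∀ x y z, ternary a b c₁ d e₁ f₁ x y z = ternary a c₁ b e₁ d f₁ x z y := by
      intro x y z; simp only [ternary]; ring
    rw [swap]
    refine ihM _ ?_ a c₁ b e₁ d f₁ hN rfl ha hC (by rw [← hdet₁]; ring) ?_ _ _ _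
    · omega
    · obtain ⟨x, y, z, h⟩ := h5₁
      exact ⟨_, _, _, swap x y z ▸ h⟩
  have hsq : 4 * (a * f₁ - d * e₁) ^ 2 ≤ (a * b - d ^ 2) ^ 2 := by
    have := pow_le_pow_left₀ (by positivity) ht₁ 2
    rw [mul_pow, sq_abs] at this
    linarith
  -- A² ≤ AC = 3a + (af₁ - de₁)² ≤ 3a + A²/4.
  have hAa : (a * b - d ^ 2) ^ 2 ≤ 4 * a := by
    have := mul_le_mul_of_nonneg_left (not_lt.1 hCA) hA.le
    nlinarith
  -- shift the second basis vector by a multiple of the first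
  obtain ⟨s, hs⟩ := exists_two_mul_add_mul_abs_le a d ha
  obtain ⟨b₂, hb₂⟩ : ∃ b₂, b₂ = b + 2 * s * d + s ^ 2 * a := ⟨_, rfl⟩
  obtain ⟨d₂, hd₂⟩ : ∃ d₂, d₂ = d + s * a := ⟨_, rfl⟩
  obtain ⟨f₂, hf₂⟩ : ∃ f₂, f₂ = f₁ + s * e₁ := ⟨_, rfl⟩
  have sub₂ : ∀ x y z,
      ternary a b c₁ d e₁ f₁ x y z = ternary a b₂ c₁ d₂ e₁ f₂ (x - s * y) y z := by
    intro x y z; simp only [ternary, hb₂, hd₂, hf₂]; ring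
  -- The second shift changes neither A nor af₁ - de₁, so the earlier bounds survive.
  have hA₂ : a * b - d ^ 2 = a * b₂ - d₂ ^ 2 := by rw [hb₂, hd₂]; ring
  have hB₂ : a * f₁ - d * e₁ = a * f₂ - d₂ * e₁ := by rw [hf₂, hd₂]; ring
  have hdet₂ : a * b₂ * c₁ + 2 * d₂ * e₁ * f₂ - a * f₂ ^ 2 - b₂ * e₁ ^ 2 - c₁ * d₂ ^ 2 = 3 := by
    rw [← hdet₁, hb₂, hd₂, hf₂]; ring
  have h5₂ : ∃ x y z, ternary a b₂ c₁ d₂ e₁ f₂ x y z % 8 = 5 := by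
    obtain ⟨x, y, z, h⟩ := h5₁
    exact ⟨_, _, _, sub₂ x y z ▸ h⟩
  rw [← hd₂] at hs
  rw [sub₂]
  generalize x - s * y = x
  rw [hA₂] at hA hAa ht₁
  rw [hB₂] at ht₁
  clear sub₂ hb₂ hd₂ hf₂ hdet₁ h5₁
  have hdsq : 4 * d₂ ^ 2 ≤ a ^ 2 := by
    have := pow_le_pow_left₀ (by positivity) hs 2
    rw [mul_pow, sq_abs] at this
    linarith
  have hb₂pos : 0 < b₂ := by
    by_contra hneg
    have := mul_nonneg ha.le (by linarith : 0 ≤ -b₂)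
    nlinarith [sq_nonneg d₂]
  by_cases hba : b₂ < a
  · have swap : ∀ x y z, ternary a b₂ c₁ d₂ e₁ f₂ x y z = ternary b₂ a c₁ d₂ f₂ e₁ y x z := by
      intro x y z; simp only [ternary]; ring
    rw [swap]
    refine ihN b₂.toNat ?_ _ b₂ a c₁ d₂ f₂ e₁ rfl rfl hb₂pos (by linarith)
      (by rw [← hdet₂]; ring) ?_ _ _ _
    · omega
    · obtain ⟨x, y, z, h⟩ := h5₂
      exact ⟨_, _, _, swap x y z ▸ h⟩
  -- From a ≤ b₂ and 2|d₂| ≤ a follows 3a² ≤ 4A; with A² ≤ 4a this gives 9a³ ≤ 64 < 9 · 2³.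
  have ha1 : a = 1 := by
    have h1 : 3 * a ^ 2 ≤ 4 * (a * b₂ - d₂ ^ 2) := by
      have := mul_le_mul_of_nonneg_left (not_lt.1 hba) ha.le
      nlinarith
    have h2 : (3 * a ^ 2) ^ 2 ≤ (4 * (a * b₂ - d₂ ^ 2)) ^ 2 := by gcongr
    by_contra hne
    have h3 : 2 ≤ a := by omega
    have h4 : 9 * a ^ 3 ≤ 64 := by
      have : a * (9 * a ^ 3) ≤ a * 64 := by nlinarith
      exact le_of_mul_le_mul_left this ha
    have h5 : (2 : ℤ) ^ 3 ≤ a ^ 3 := by gcongr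
    linarith
  subst ha1
  have hd₂ : d₂ = 0 := by
    have := neg_abs_le d₂
    have := le_abs_self d₂
    omega
  subst hd₂
  have sub₃ : ∀ x y z, ternary 1 b₂ c₁ 0 e₁ f₂ x y z =
      ternary 1 b₂ (c₁ - e₁ ^ 2) 0 0 f₂ (x + e₁ * z) y z := by
    intro x y z; simp only [ternary]; ring
  rw [sub₃]
  refine exists_sq_add_sq_add_three_mul_sq_of_reduced hb₂pos (by linarith) ?_ ?_ ?_ _ _ _
  · simpa using ht₁
  · simpa using hAa
  · obtain ⟨x, y, z, h⟩ := h5₂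
    exact ⟨_, _, _, sub₃ x y z ▸ h⟩

/-! ### Integers represented by x² + y² + 3z² -/

lemma jacobiSym_neg_three {e : ℕ} (he : e % 6 = 5) : jacobiSym (-3) e = -1 := by
  rw [jacobiSym.mod_right _ (Nat.odd_iff.2 (by omega))]
  have : e % (4 * (-3 : ℤ).natAbs) = 5 ∨ e % (4 * (-3 : ℤ).natAbs) = 11 := by
    simp only [Int.natAbs_neg]
    change e % 12 = 5 ∨ e % 12 = 11
    omega
  rcases this with h | h <;> rw [h] <;> norm_num

/-- -8e is a square mod p: (-1/p) = 1 and (2/p) = -1 as p ≡ 5 mod 8, and (e/p) = (p/e) = -1 by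
reciprocity. -/
lemma exists_dvd_sq_add_eight_mul {p e : ℕ} (hp : p.Prime) (hp8 : p % 8 = 5) (he : Odd e)
    (hj : jacobiSym p e = -1) : ∃ k : ℤ, (p : ℤ) ∣ k ^ 2 + 8 * e := by
  have : Fact p.Prime := ⟨hp⟩
  have hodd : Odd p := Nat.odd_iff.2 (by omega)
  have h2 : jacobiSym 2 p = -1 := by
    rw [jacobiSym.at_two hodd, ZMod.χ₈_nat_eq_if_mod_eight, hp8, if_neg (by omega)]; rfl
  have h1 : jacobiSym (-1) p = 1 := by
    rw [jacobiSym.at_neg_one hodd, ZMod.χ₄_nat_one_mod_four (by omega)]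
  have h3 : jacobiSym e p = -1 := by
    rw [← jacobiSym.quadratic_reciprocity_one_mod_four (by omega) he, hj]
  have h : jacobiSym (-1 * 2 ^ 3 * e) p = 1 := by
    rw [jacobiSym.mul_left, jacobiSym.mul_left, jacobiSym.pow_left, h1, h2, h3]; norm_num
  rw [← jacobiSym.legendreSym.to_jacobiSym] at h
  have hne : ((-1 * 2 ^ 3 * e : ℤ) : ZMod p) ≠ 0 := by
    intro h0
    rw [(legendreSym.eq_zero_iff p _).2 h0] at h
    exact zero_ne_one h
  obtain ⟨r, hr⟩ := (legendreSym.eq_one_iff p hne).1 h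
  refine ⟨r.val, ?_⟩
  rw [← ZMod.intCast_zmod_eq_zero_iff_dvd]
  push_cast at hr ⊢
  rw [ZMod.natCast_val, ZMod.cast_id', id, pow_two, ← hr]
  ring

/-- With ap - k² = 8e, the Gram matrix with rows (a, k, g), (k, p, 0), (g, 0, n) has determinant 8en
- pg² = 3, and its form represents both p ≡ 5 mod 8 and n. -/
lemma exists_eq_sq_add_sq_add_three_mul_sq_of_prime {n p e : ℕ} {g : ℤ} (hp : p.Prime)
    (hp8 : p % 8 = 5) (he : 0 < e) (hodd : Odd e) (hj : jacobiSym p e = -1)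
    (hdet : (8 * e * n : ℤ) = p * g ^ 2 + 3) :
    ∃ x y z : ℤ, (n : ℤ) = x ^ 2 + y ^ 2 + 3 * z ^ 2 := by
  obtain ⟨k, a, ha⟩ := exists_dvd_sq_add_eight_mul hp hp8 hodd hj
  have hp0 : (0 : ℤ) < p := by exact_mod_cast hp.pos
  have he0 : (0 : ℤ) < e := by exact_mod_cast he
  have ha0 : 0 < a := by
    refine pos_of_mul_pos_right (a := (p : ℤ)) ?_ hp0.le
    rw [← ha]; positivity
  have hA : a * p - k ^ 2 = 8 * e := by linarith
  obtain ⟨X, Y, Z, h⟩ := exists_sq_add_sq_add_three_mul_sq_of_det_eq_three _ _ a p n k g 0 rfl rfl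
    ha0 (by rw [hA]; positivity) (by linear_combination n * hA + hdet)
    ⟨0, 1, 0, by simp [ternary]; omega⟩ 0 0 1
  exact ⟨X, Y, Z, by simpa [ternary] using h⟩

/-- The form `x² + y² + 3 z²` represents every positive integer prime to `3`. -/
theorem exists_eq_sq_add_sq_add_three_mul_sq_of_not_dvd {n : ℕ} (hn : n % 3 ≠ 0) :
    ∃ x y z : ℤ, (n : ℤ) = x ^ 2 + y ^ 2 + 3 * z ^ 2 := by
  have hcop : (40 * n - 3).Coprime (48 * n) := by
    refine Nat.Coprime.symm (Nat.coprime_of_dvd fun q hq h1 h2 => ?_)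
    rcases (Nat.Prime.dvd_mul hq).1 h1 with h | h
    · have : q ∣ 2 ^ 4 * 3 := h
      rcases (Nat.Prime.dvd_mul hq).1 this with h | h
      · have := (Nat.prime_dvd_prime_iff_eq hq Nat.prime_two).1 (hq.dvd_of_dvd_pow h)
        subst this; omega
      · have := (Nat.prime_dvd_prime_iff_eq hq Nat.prime_three).1 h
        subst this; omega
    · have h3 : q ∣ 40 * n - (40 * n - 3) := Nat.dvd_sub (h.mul_left _) h2
      rw [show 40 * n - (40 * n - 3) = 3 by omega] at h3
      have := (Nat.prime_dvd_prime_iff_eq hq Nat.prime_three).1 h3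
      subst this; omega
  -- The class is chosen so that p + 3 = 8en with e ≡ 5 mod 6; then p ≡ -3 mod e and (p/e) = (-3/e)
  -- = -1.
  obtain ⟨p, hp, hprime, hmod⟩ :=
    Nat.forall_exists_prime_gt_and_modEq (40 * n - 3) (by omega : 48 * n ≠ 0) hcop
  obtain ⟨t, ht⟩ := (Nat.modEq_iff_dvd' hp.le).1 hmod.symm
  have hp3 : p + 3 = 8 * (6 * t + 5) * n := by
    have : 8 * (6 * t + 5) * n = 48 * n * t + 40 * n := by ring
    omega
  have hp8 : p % 8 = 5 := by
    rw [mul_assoc] at hp3; omega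
  refine exists_eq_sq_add_sq_add_three_mul_sq_of_prime (e := 6 * t + 5) (g := 1) hprime hp8
    (by omega) (Nat.odd_iff.2 (by omega)) ?_ (by push_cast; exact_mod_cast (by linarith))
  rw [← jacobiSym_neg_three (e := 6 * t + 5) (by omega)]
  refine jacobiSym.mod_left' (Int.modEq_iff_dvd.2 ⟨-(8 * n), ?_⟩)
  zify at hp3
  push_cast
  linarith

/-- The form `x² + y² + 3 z²` represents every natural number congruent to `3` modulo `9`. -/
theorem exists_eq_sq_add_sq_add_three_mul_sq_of_mod_nine {n : ℕ} (hn : n % 9 = 3) :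
    ∃ x y z : ℤ, (n : ℤ) = x ^ 2 + y ^ 2 + 3 * z ^ 2 := by
  obtain ⟨s, rfl⟩ : ∃ s, n = 9 * s + 3 := ⟨n / 9, by omega⟩
  have hcop : (40 * s + 13).Coprime (16 * (3 * s + 1)) := by
    refine Nat.Coprime.symm (Nat.coprime_of_dvd fun q hq h1 h2 => ?_)
    rcases (Nat.Prime.dvd_mul hq).1 h1 with h | h
    · have : q ∣ 2 ^ 4 := h
      have := (Nat.prime_dvd_prime_iff_eq hq Nat.prime_two).1 (hq.dvd_of_dvd_pow this)
      subst this; omega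
    · have h3 : q ∣ 40 * (3 * s + 1) - 3 * (40 * s + 13) :=
        Nat.dvd_sub (h.mul_left _) (h2.mul_left _)
      rw [show 40 * (3 * s + 1) - 3 * (40 * s + 13) = 1 by omega] at h3
      exact hq.one_lt.ne' (Nat.dvd_one.1 h3)
  -- Here 3 ∣ n, so g = 3: the condition 8en = 9p + 3 becomes 3p + 1 = 8e(3s + 1), whence -3p ≡ 1
  -- mod e.
  obtain ⟨p, hp, hprime, hmod⟩ :=
    Nat.forall_exists_prime_gt_and_modEq (40 * s + 13) (by omega : 16 * (3 * s + 1) ≠ 0) hcop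
  obtain ⟨t, ht⟩ := (Nat.modEq_iff_dvd' hp.le).1 hmod.symm
  have hp3 : 3 * p + 1 = 8 * (6 * t + 5) * (3 * s + 1) := by
    have : 8 * (6 * t + 5) * (3 * s + 1) = 3 * (16 * (3 * s + 1) * t) + 120 * s + 40 := by ring
    omega
  have hp8 : p % 8 = 5 := by
    rw [mul_assoc] at hp3; omega
  have hj := jacobiSym_neg_three (e := 6 * t + 5) (by omega)
  refine exists_eq_sq_add_sq_add_three_mul_sq_of_prime (e := 6 * t + 5) (g := 3) hprime hp8
    (by omega) (Nat.odd_iff.2 (by omega)) ?_ (by zify at hp3; push_cast; linarith)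
  have h1 : jacobiSym (-3 * p) (6 * t + 5 : ℕ) = jacobiSym 1 (6 * t + 5 : ℕ) := by
    refine jacobiSym.mod_left' (Int.modEq_iff_dvd.2 ⟨8 * (3 * s + 1), ?_⟩)
    zify at hp3
    push_cast
    linarith
  rw [jacobiSym.mul_left, hj, jacobiSym.one_left] at h1
  linarith

lemma exists_eq_ternary_of_mod {n : ℕ} (hn : n % 3 ≠ 0 ∨ n % 9 = 3) :
    ∃ x y z : ℤ, (n : ℤ) = x ^ 2 + y ^ 2 + 3 * z ^ 2 :=
  hn.elim exists_eq_sq_add_sq_add_three_mul_sq_of_not_dvd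
    exists_eq_sq_add_sq_add_three_mul_sq_of_mod_nine

/-! ### Quaternary forms and the obstruction at 3 -/

/-- The form `x² + y² + 3 z² + w²` is universal. -/
theorem exists_eq_sq_add_sq_add_three_mul_sq_add_sq (n : ℕ) :
    ∃ x y z w : ℤ, (n : ℤ) = x ^ 2 + y ^ 2 + 3 * z ^ 2 + w ^ 2 := by
  induction n using Nat.strong_induction_on with
  | _ n ih =>
  by_cases h : n % 3 ≠ 0 ∨ n % 9 = 3
  · obtain ⟨x, y, z, h⟩ := exists_eq_ternary_of_mod h
    exact ⟨x, y, z, 0, by rw [h]; ring⟩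
  by_cases h6 : n % 9 = 6
  -- Here n - 1 ≡ 5 mod 9 is prime to 3, so w = 1 works.
  · obtain ⟨x, y, z, h⟩ := exists_eq_ternary_of_mod (n := n - 1) (by omega)
    refine ⟨x, y, z, 1, ?_⟩
    rw [← h]
    omega
  obtain ⟨m, rfl⟩ : ∃ m, n = 9 * m := ⟨n / 9, by omega⟩
  rcases Nat.eq_zero_or_pos m with rfl | hm
  · exact ⟨0, 0, 0, 0, by simp⟩
  obtain ⟨x, y, z, w, h⟩ := ih m (by omega)
  exact ⟨3 * x, 3 * y, 3 * z, 3 * w, by push_cast; rw [h]; ring⟩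

/-- Dividing n by 9 lowers s by one, since the last coefficient absorbs the factor 9; s = 0 is the
universal form. -/
theorem exists_eq_sq_add_sq_add_three_mul_sq_add_nine_pow_mul_sq (s n : ℕ)
    (hn : ∀ j < s, ∀ q, n ≠ 9 ^ j * (9 * q + 6)) :
    ∃ x y z w : ℤ, (n : ℤ) = x ^ 2 + y ^ 2 + 3 * z ^ 2 + 9 ^ s * w ^ 2 := by
  induction s generalizing n with
  | zero => simpa using exists_eq_sq_add_sq_add_three_mul_sq_add_sq n
  | succ s ih =>
    by_cases h : n % 3 ≠ 0 ∨ n % 9 = 3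
    · obtain ⟨x, y, z, h⟩ := exists_eq_ternary_of_mod h
      exact ⟨x, y, z, 0, by rw [h]; ring⟩
    have h6 := hn 0 s.succ_pos (n / 9)
    obtain ⟨m, rfl⟩ : ∃ m, n = 9 * m := ⟨n / 9, by omega⟩
    obtain ⟨x, y, z, w, h⟩ := ih m fun j hj q hm => hn (j + 1) (by omega) q (by rw [hm]; ring)
    exact ⟨3 * x, 3 * y, 3 * z, w, by push_cast; rw [h]; ring⟩

/-- In `ZMod 9`, `3 * x = 0` expresses that 3 divides x. -/
lemma sq_add_sq_add_three_mul_sq_zmod_nine : ∀ x y z : ZMod 9,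
    x ^ 2 + y ^ 2 + 3 * z ^ 2 ≠ 6 ∧
      (x ^ 2 + y ^ 2 + 3 * z ^ 2 = 0 → 3 * x = 0 ∧ 3 * y = 0 ∧ 3 * z = 0) := by
  decide

lemma three_dvd_of_zmod_nine {x : ℤ} (h : 3 * (x : ZMod 9) = 0) : ∃ y, x = 3 * y := by
  have : ((3 * x : ℤ) : ZMod 9) = 0 := by exact_mod_cast h
  obtain ⟨c, hc⟩ := (ZMod.intCast_zmod_eq_zero_iff_dvd _ 9).1 this
  exact ⟨c, by push_cast at hc; omega⟩

/-- Modulo `9 ^ s`, the form `x² + y² + 3 z²` represents no `9 ^ j * (9 * q + 6)` with `j < s`. -/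
theorem sq_add_sq_add_three_mul_sq_add_nine_pow_mul_ne (s j : ℕ) (hj : j < s) (x y z w q : ℤ) :
    x ^ 2 + y ^ 2 + 3 * z ^ 2 + 9 ^ s * w ≠ 9 ^ j * (9 * q + 6) := by
  induction s generalizing j x y z with
  | zero => omega
  | succ s ih =>
    intro h
    have h9 := congrArg (Int.cast : ℤ → ZMod 9) h
    have h90 : (9 : ZMod 9) = 0 := rfl
    have key := sq_add_sq_add_three_mul_sq_zmod_nine x y z
    push_cast [pow_succ (9 : ZMod 9), h90] at h9
    cases j with
    | zero => exact key.1 (by simpa using h9)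
    | succ j =>
      obtain ⟨hx, hy, hz⟩ := key.2 (by simpa [pow_succ, h90] using h9)
      obtain ⟨x, rfl⟩ := three_dvd_of_zmod_nine hx
      obtain ⟨y, rfl⟩ := three_dvd_of_zmod_nine hy
      obtain ⟨z, rfl⟩ := three_dvd_of_zmod_nine hz
      refine ih j (by omega) x y z (mul_left_cancel₀ (by norm_num : (9 : ℤ) ≠ 0) ?_)
      linear_combination h

/-- The diagonal form `⟨1, 3, 9, 9 ^ r⟩` represents every natural number outside the listed
residue classes. -/
theorem exists_eq_one_three_nine_nine_pow {r : ℕ} (hr : 1 ≤ r) {n : ℕ} (h2 : n % 3 ≠ 2)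
    (hn : ∀ j < r, ∀ q, n ≠ 9 ^ j * (9 * q + 6)) :
    ∃ x y z w : ℤ, (n : ℤ) = x ^ 2 + 3 * y ^ 2 + 9 * z ^ 2 + 9 ^ r * w ^ 2 := by
  obtain ⟨s, rfl⟩ : ∃ s, r = s + 1 := ⟨r - 1, by omega⟩
  by_cases h : n % 3 ≠ 0 ∨ n % 9 = 3
  · obtain ⟨x, y, z, hxyz⟩ := exists_eq_ternary_of_mod h
    -- As n ≢ 2 mod 3, one of x, y is divisible by 3, and its square supplies the coefficient 9.
    have key : ∀ x y : ZMod 3, x ^ 2 + y ^ 2 ≠ 2 → x = 0 ∨ y = 0 := by decide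
    have hmod : ((x : ZMod 3)) ^ 2 + (y : ZMod 3) ^ 2 ≠ 2 := by
      intro h'
      have h3 := congrArg (Int.cast : ℤ → ZMod 3) hxyz
      push_cast at h3
      rw [h', show (3 : ZMod 3) = 0 from rfl, zero_mul, add_zero] at h3
      exact h2 ((ZMod.natCast_eq_natCast_iff' n 2 3).1 h3)
    rcases key _ _ hmod with h0 | h0 <;>
      obtain ⟨t, rfl⟩ := (ZMod.intCast_zmod_eq_zero_iff_dvd _ 3).1 h0
    · exact ⟨y, z, t, 0, by rw [hxyz]; push_cast; ring⟩
    · exact ⟨x, z, t, 0, by rw [hxyz]; push_cast; ring⟩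
  have h6 := hn 0 s.succ_pos (n / 9)
  obtain ⟨m, rfl⟩ : ∃ m, n = 9 * m := ⟨n / 9, by omega⟩
  -- Nine times ⟨1, 1, 3, 9^s⟩ is ⟨9, 9, 27, 9^r⟩, a subform of ⟨1, 9, 3, 9^r⟩.
  obtain ⟨x, y, z, w, h⟩ := exists_eq_sq_add_sq_add_three_mul_sq_add_nine_pow_mul_sq s m
    fun j hj q hm => hn (j + 1) (by omega) q (by rw [hm]; ring)
  exact ⟨3 * x, 3 * z, y, w, by push_cast; rw [h]; ring⟩

/-- The diagonal form `⟨1, 1, 3, 9⟩` represents every natural number not congruent to `6`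
modulo `9`. -/
theorem exists_eq_one_one_three_nine {n : ℕ} (hn : n % 9 ≠ 6) :
    ∃ x y z w : ℤ, (n : ℤ) = x ^ 2 + y ^ 2 + 3 * z ^ 2 + 9 * w ^ 2 := by
  simpa using exists_eq_sq_add_sq_add_three_mul_sq_add_nine_pow_mul_sq 1 n
    fun j hj q hq => hn (by obtain rfl : j = 0 := by omega
                            omega)

lemma one_three_nine_nine_pow_emod_three_ne {r : ℕ} (hr : 1 ≤ r) (x y z w : ℤ) :
    (x ^ 2 + 3 * y ^ 2 + 9 * z ^ 2 + 9 ^ r * w) % 3 ≠ 2 := by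
  obtain ⟨s, rfl⟩ : ∃ s, r = s + 1 := ⟨r - 1, by omega⟩
  have key : ∀ x : ZMod 3, x ^ 2 ≠ 2 := by decide
  intro h
  apply key x
  have h' : x ^ 2 + 3 * y ^ 2 + 9 * z ^ 2 + 9 ^ (s + 1) * w ≡ 2 [ZMOD 3] := h
  have h3 := (ZMod.intCast_eq_intCast_iff _ _ 3).2 h'
  push_cast at h3
  rw [pow_succ, show (9 : ZMod 3) = 0 from rfl, show (3 : ZMod 3) = 0 from rfl] at h3
  simpa [pow_two] using h3

/-! ### Admissible progressions -/

lemma isAdmissible_two_mul_three_pow {i : ℕ} : IsAdmissible (2 * 3 ^ i) (3 ^ (i + 1)) := by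
  refine ⟨by positivity, ?_, fun p hp hdvd => ?_⟩
  · rw [pow_succ]; have : 0 < 3 ^ i := by positivity
    omega
  · obtain rfl := (Nat.prime_dvd_prime_iff_eq hp Nat.prime_three).1 (hp.dvd_of_dvd_pow hdvd)
    have : Fact (Nat.Prime 3) := ⟨Nat.prime_three⟩
    rw [padicValNat.mul (by norm_num) (by positivity), padicValNat.prime_pow,
      padicValNat.prime_pow, padicValNat.eq_zero_of_not_dvd (by norm_num)]
    omega

/-- p^(ord_p a + 1) divides m, so adding multiples of m to a cannot alter the order. -/
lemma padicValNat_eq_of_mem_progression {a m n p : ℕ} (h : IsAdmissible a m) (hp : p.Prime)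
    (hpm : p ∣ m) (hn : n ∈ progression a m) : padicValNat p n = padicValNat p a := by
  have : Fact p.Prime := ⟨hp⟩
  obtain ⟨x, rfl⟩ := hn
  have hlt := h.2.2 p hp hpm
  have ha : a ≠ 0 := h.1.ne'
  have hs : a + m * x ≠ 0 := by omega
  have hm : p ^ (padicValNat p a + 1) ∣ m * x :=
    ((pow_dvd_pow p hlt).trans pow_padicValNat_dvd).mul_right x
  apply le_antisymm
  · by_contra! hgt
    have h1 : p ^ (padicValNat p a + 1) ∣ a + m * x :=
      (pow_dvd_pow p hgt).trans pow_padicValNat_dvd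
    exact pow_succ_padicValNat_not_dvd ha ((Nat.dvd_add_left hm).1 h1)
  · rw [← padicValNat_dvd_iff_le hs]
    exact dvd_add pow_padicValNat_dvd ((pow_dvd_pow p (Nat.le_succ _)).trans hm)

/-- If a set contains `t` elements with distinct `p`-adic orders and misses a residue class
modulo `p`, then it is not a union of fewer than `t` admissible progressions. -/
theorem not_isUnionOfAdmissible {S : Set ℕ} {p c t k : ℕ} (hp : p.Prime)
    (hS : ∀ n ∈ S, ¬ n ≡ c [MOD p]) (f : Fin t → ℕ) (hf : ∀ i, f i ∈ S)
    (hinj : Function.Injective fun i => padicValNat p (f i)) (hk : k < t) :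
    ¬ IsUnionOfAdmissible S k := by
  rintro ⟨a, m, hadm, rfl⟩
  choose g hg using fun i => Set.mem_iUnion.1 (hf i)
  obtain ⟨i, j, hij, hgij⟩ := Fintype.exists_ne_map_eq_of_card_lt g (by simpa using hk)
  by_cases hpm : p ∣ m (g i)
  · refine hij (hinj ?_)
    dsimp only
    have hj := hg j
    rw [← hgij] at hj
    rw [padicValNat_eq_of_mem_progression (hadm _) hp hpm (hg i),
      padicValNat_eq_of_mem_progression (hadm _) hp hpm hj]
  -- If p ∤ m, solving a + mx ≡ c mod p puts an element of the missed class into S.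
  · have : Fact p.Prime := ⟨hp⟩
    have hm : (m (g i) : ZMod p) ≠ 0 := by rwa [Ne, ZMod.natCast_eq_zero_iff]
    refine hS (a (g i) + m (g i) * ((c - a (g i) : ZMod p) / m (g i)).val)
      (Set.mem_iUnion.2 ⟨_, _, rfl⟩) ((ZMod.natCast_eq_natCast_iff _ _ _).1 ?_)
    push_cast
    rw [ZMod.natCast_val, ZMod.cast_id', id, mul_div_cancel₀ _ hm]
    ring

/-! ### Diagonal lattices -/

lemma associated_sum_sum {R M : Type*} [CommRing R] [Invertible (2 : R)] [AddCommGroup M]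
    [Module R M] (Q : QuadraticForm R M) {n : ℕ} (v : Fin n → M) (a : Fin n → R)
    (h : ∀ i j, QuadraticMap.associated Q (v i) (v j) = Matrix.diagonal a i j)
    (c d : Fin n → R) :
    QuadraticMap.associated Q (∑ i, c i • v i) (∑ j, d j • v j) = ∑ i, a i * (c i * d i) := by
  simp only [map_sum, LinearMap.sum_apply, map_smul, LinearMap.smul_apply, h, smul_eq_mul]
  refine Finset.sum_congr rfl fun i _ => ?_
  rw [Finset.sum_eq_single i]
  · simp only [Matrix.diagonal_apply_eq]; ring
  · intro j _ hj; simp [Matrix.diagonal_apply_ne _ hj]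
  · simp

lemma quadraticForm_sum {R M : Type*} [CommRing R] [Invertible (2 : R)] [AddCommGroup M]
    [Module R M] (Q : QuadraticForm R M) {n : ℕ} (v : Fin n → M) (a : Fin n → R)
    (h : ∀ i j, QuadraticMap.associated Q (v i) (v j) = Matrix.diagonal a i j)
    (c : Fin n → R) : Q (∑ i, c i • v i) = ∑ i, a i * c i ^ 2 := by
  rw [← QuadraticMap.associated_eq_self_apply R Q, associated_sum_sum Q v a h]
  simp only [pow_two]

section

variable {V : Type*} [AddCommGroup V] [Module ℚ V] {Q : QuadraticForm ℚ V} {L : Submodule ℤ V}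
  {n : ℕ} {a : Fin n → ℤ}

lemma bilin_basis {b : Module.Basis (Fin n) ℤ L}
    (hb : (Matrix.of fun i j => bilin Q (b i : V) (b j : V)) = Matrix.diagonal fun i => (a i : ℚ))
    (i j : Fin n) :
    QuadraticMap.associated Q (b i : V) (b j : V) = Matrix.diagonal (fun i => (a i : ℚ)) i j := by
  rw [← hb]; rfl

lemma coe_eq_sum_repr (b : Module.Basis (Fin n) ℤ L) (v : L) :
    (v : V) = ∑ i, ((b.repr v i : ℤ) : ℚ) • (b i : V) := by
  conv_lhs => rw [← b.sum_repr v]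
  simp only [Submodule.coe_sum, Submodule.coe_smul_of_tower, Int.cast_smul_eq_zsmul]

lemma bilin_mem_range {x y : V} (h : IsDiagonal Q L a) (hx : x ∈ L) (hy : y ∈ L) :
    ∃ c : ℤ, bilin Q x y = c := by
  obtain ⟨b, hb⟩ := h
  have h1 := coe_eq_sum_repr b ⟨x, hx⟩
  have h2 := coe_eq_sum_repr b ⟨y, hy⟩
  dsimp only at h1 h2
  rw [h1, h2, bilin, associated_sum_sum Q _ _ (bilin_basis hb)]
  exact ⟨∑ i, a i * (b.repr ⟨x, hx⟩ i * b.repr ⟨y, hy⟩ i), by push_cast; rfl⟩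

lemma scale_eq_one (h : IsDiagonal Q L a) (i : Fin n) (hi : a i = 1) : scale Q L = 1 := by
  apply le_antisymm
  · refine Submodule.span_le.2 ?_
    rintro c ⟨x, hx, y, hy, rfl⟩
    obtain ⟨c, hc⟩ := bilin_mem_range h hx hy
    exact hc ▸ Submodule.mem_one.2 ⟨c, by simp⟩
  · obtain ⟨b, hb⟩ := h
    rw [Submodule.one_eq_span, Submodule.span_le, Set.singleton_subset_iff]
    refine Submodule.subset_span ⟨b i, (b i).2, b i, (b i).2, ?_⟩
    rw [bilin, bilin_basis hb, Matrix.diagonal_apply_eq, hi, Int.cast_one]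

lemma mem_valueSet_iff (h : IsDiagonal Q L a) (c : ℚ) :
    c ∈ valueSet Q L ↔ ∃ x : Fin n → ℤ, c = ((∑ i, a i * x i ^ 2 : ℤ) : ℚ) := by
  obtain ⟨b, hb⟩ := h
  constructor
  · rintro ⟨v, hv, rfl⟩
    have h1 := coe_eq_sum_repr b ⟨v, hv⟩
    dsimp only at h1
    refine ⟨b.repr ⟨v, hv⟩, ?_⟩
    conv_lhs => rw [h1, quadraticForm_sum Q _ _ (bilin_basis hb)]
    push_cast
    rfl
  · rintro ⟨x, rfl⟩
    refine ⟨∑ i, (x i : ℚ) • (b i : V), ?_, ?_⟩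
    · refine Submodule.sum_mem _ fun i _ => ?_
      rw [Int.cast_smul_eq_zsmul]
      exact L.smul_mem _ (b i).2
    · rw [quadraticForm_sum Q _ _ (bilin_basis hb)]
      push_cast
      rfl

lemma isPosDef_of_isDiagonal (h : IsDiagonal Q L a) (ha : ∀ i, 0 < a i) : IsPosDef Q L := by
  obtain ⟨b, hb⟩ := h
  intro v hv hv0
  have h1 := coe_eq_sum_repr b ⟨v, hv⟩
  dsimp only at h1
  rw [h1, quadraticForm_sum Q _ _ (bilin_basis hb)]
  have ha' : ∀ i, (0 : ℚ) < a i := fun i => by exact_mod_cast ha i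
  obtain ⟨i, hi⟩ : ∃ i, b.repr ⟨v, hv⟩ i ≠ 0 := by
    by_contra! h0
    rw [h1] at hv0
    exact hv0 (by simp [h0])
  refine Finset.sum_pos' (fun i _ => mul_nonneg (ha' i).le (sq_nonneg _))
    ⟨i, Finset.mem_univ _, mul_pos (ha' i) ?_⟩
  have : ((b.repr ⟨v, hv⟩ i : ℤ) : ℚ) ≠ 0 := by exact_mod_cast hi
  positivity

/-- Bounds Q on all of V, hence on every lattice of the genus. -/
lemma quadraticForm_nonneg [Submodule.IsLattice ℚ L] (h : IsDiagonal Q L a) (ha : ∀ i, 0 ≤ a i)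
    (v : V) : 0 ≤ Q v := by
  obtain ⟨b, hb⟩ := h
  have h1 := ((b.extendOfIsLattice ℚ).sum_repr v).symm
  simp only [Module.Basis.extendOfIsLattice_apply] at h1
  rw [h1, quadraticForm_sum Q _ _ (bilin_basis hb)]
  exact Finset.sum_nonneg fun i _ => mul_nonneg (by exact_mod_cast ha i) (sq_nonneg _)

/-! ### Localization and values of the genus -/

lemma mem_genus_self [Submodule.IsLattice ℚ L] : L ∈ genus Q L :=
  ⟨inferInstance, fun _ _ => ⟨QuadraticMap.IsometryEquiv.refl _, Set.image_id _⟩⟩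

lemma exists_eq_sum_of_mem_localization (p : ℕ) [Fact p.Prime] (b : Module.Basis (Fin n) ℤ L)
    {u : ℚ_[p] ⊗[ℚ] V} (hu : u ∈ localization p L) :
    ∃ x : Fin n → ℤ_[p], u = ∑ i, (x i : ℚ_[p]) • ((1 : ℚ_[p]) ⊗ₜ[ℚ] (b i : V)) := by
  have hle : localization p L ≤
      Submodule.span ℤ_[p] (Set.range fun i => (1 : ℚ_[p]) ⊗ₜ[ℚ] (b i : V)) := by
    refine Submodule.span_le.2 ?_
    rintro _ ⟨v, hv, rfl⟩
    have h1 := coe_eq_sum_repr b ⟨v, hv⟩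
    dsimp only at h1 ⊢
    rw [h1, TensorProduct.tmul_sum]
    refine Submodule.sum_mem _ fun i _ => ?_
    rw [Int.cast_smul_eq_zsmul, TensorProduct.tmul_smul]
    exact Submodule.smul_of_tower_mem _ _ (Submodule.subset_span ⟨i, rfl⟩)
  obtain ⟨x, hx⟩ := (Submodule.mem_span_range_iff_exists_fun ℤ_[p]).1 (hle hu)
  exact ⟨x, hx.symm⟩

/-- A number represented by a lattice in the genus of a diagonal lattice is represented by the
diagonal form over the `p`-adic integers. -/
lemma exists_padicInt_of_mem_genus (h : IsDiagonal Q L a) {K : Submodule ℤ V}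
    (hK : K ∈ genus Q L) {c : ℚ} (hc : c ∈ valueSet Q K) (p : ℕ) [Fact p.Prime] :
    ∃ x : Fin n → ℤ_[p], (c : ℚ_[p]) = ∑ i, (a i : ℚ_[p]) * (x i : ℚ_[p]) ^ 2 := by
  obtain ⟨b, hb⟩ := h
  obtain ⟨v, hv, rfl⟩ := hc
  obtain ⟨σ, hσ⟩ := hK.2 p
  -- Pulling v back through the isometry gives a vector of L_p with the same value, a p-adic
  -- combination of the basis of L.
  have hv' : (1 : ℚ_[p]) ⊗ₜ[ℚ] v ∈ (localization p K : Set (ℚ_[p] ⊗[ℚ] V)) :=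
    Submodule.subset_span ⟨v, hv, rfl⟩
  rw [← hσ] at hv'
  obtain ⟨u, hu, huv⟩ := hv'
  obtain ⟨x, rfl⟩ := exists_eq_sum_of_mem_localization p b hu
  refine ⟨x, ?_⟩
  have h1 := σ.map_app (∑ i, (x i : ℚ_[p]) • ((1 : ℚ_[p]) ⊗ₜ[ℚ] (b i : V)))
  change Q.baseChange ℚ_[p] (σ _) = _ at h1
  rw [huv, QuadraticForm.baseChange_tmul,
    quadraticForm_sum _ _ (fun i => (a i : ℚ_[p]))] at h1
  · rw [← h1]; simp [Algebra.smul_def]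
  · intro i j
    rw [QuadraticForm.associated_baseChange, LinearMap.BilinForm.baseChange_tmul, bilin_basis hb]
    rcases eq_or_ne i j with rfl | hij
    · simp [Algebra.smul_def]
    · simp [Matrix.diagonal_apply_ne _ hij]

lemma exists_int_dvd_sub_of_padicInt {p : ℕ} [Fact p.Prime] (c : ℤ) (x : Fin n → ℤ_[p])
    (h : (c : ℚ_[p]) = ∑ i, (a i : ℚ_[p]) * (x i : ℚ_[p]) ^ 2) (k : ℕ) :
    ∃ y : Fin n → ℤ, (p : ℤ) ^ k ∣ c - ∑ i, a i * y i ^ 2 := by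
  have h1 : (c : ℤ_[p]) = ∑ i, (a i : ℤ_[p]) * x i ^ 2 := by
    apply PadicInt.ext
    rw [PadicInt.coe_sum]
    simpa using h
  have h2 := congrArg (PadicInt.toZModPow k) h1
  simp only [map_intCast, map_sum, map_mul, map_pow] at h2
  have : NeZero (p ^ k) := ⟨pow_ne_zero _ (Fact.out : p.Prime).ne_zero⟩
  refine ⟨fun i => (PadicInt.toZModPow k (x i)).val, ?_⟩
  rw [← Nat.cast_pow, ← ZMod.intCast_zmod_eq_zero_iff_dvd]
  push_cast
  simp only [ZMod.natCast_val, ZMod.cast_id', id, h2, sub_self]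

end

/-! ### The union of the progressions -/

lemma mem_progression_iff {j n : ℕ} :
    n ∈ progression (2 * 3 ^ (2 * (j + 1) - 1)) (3 ^ (2 * (j + 1))) ↔
      ∃ q, n = 9 ^ j * (9 * q + 6) := by
  have h1 : 2 * 3 ^ (2 * (j + 1) - 1) = 9 ^ j * 6 := by
    rw [show 2 * (j + 1) - 1 = 2 * j + 1 by omega, pow_succ, pow_mul]; ring
  have h2 : 3 ^ (2 * (j + 1)) = 9 ^ j * 9 := by rw [pow_mul, pow_succ]; norm_num
  rw [h1, h2]
  exact exists_congr fun q => by rw [mul_add, mul_assoc, add_comm]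

lemma mem_progression_two_three_iff {n : ℕ} : n ∈ progression 2 3 ↔ n % 3 = 2 :=
  ⟨fun ⟨x, hx⟩ => by omega, fun h => ⟨n / 3, by omega⟩⟩

lemma mem_union_progression_iff {r n : ℕ} :
    n ∈ progression 2 3 ∪ ⋃ i ∈ Finset.Icc 1 r, progression (2 * 3 ^ (2 * i - 1)) (3 ^ (2 * i)) ↔
      n % 3 = 2 ∨ ∃ j < r, ∃ q, n = 9 ^ j * (9 * q + 6) := by
  rw [Set.mem_union, mem_progression_two_three_iff]
  refine or_congr_right ?_
  simp only [Set.mem_iUnion, Finset.mem_Icc]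
  constructor
  · rintro ⟨i, hi, h⟩
    obtain ⟨j, rfl⟩ : ∃ j, i = j + 1 := ⟨i - 1, by omega⟩
    exact ⟨j, by omega, mem_progression_iff.1 h⟩
  · rintro ⟨j, hj, h⟩
    exact ⟨j + 1, by omega, mem_progression_iff.2 h⟩

/-- The factor w need not be a square, so a congruence modulo 9^r is enough; regularity uses this.
-/
lemma not_mem_union_progression {r n : ℕ} (hr : 1 ≤ r) {x y z w : ℤ}
    (h : (n : ℤ) = x ^ 2 + 3 * y ^ 2 + 9 * z ^ 2 + 9 ^ r * w) :
    n ∉ progression 2 3 ∪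
      ⋃ i ∈ Finset.Icc 1 r, progression (2 * 3 ^ (2 * i - 1)) (3 ^ (2 * i)) := by
  rw [mem_union_progression_iff]
  rintro (h2 | ⟨j, hj, q, rfl⟩)
  · refine one_three_nine_nine_pow_emod_three_ne hr x y z w ?_
    rw [← h]
    omega
  · refine sq_add_sq_add_three_mul_sq_add_nine_pow_mul_ne r j hj x (3 * z) y w q ?_
    push_cast at h
    linear_combination -h

lemma exists_of_not_mem_union_progression {r n : ℕ} (hr : 1 ≤ r)
    (hn : n ∉ progression 2 3 ∪
      ⋃ i ∈ Finset.Icc 1 r, progression (2 * 3 ^ (2 * i - 1)) (3 ^ (2 * i))) :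
    ∃ x y z w : ℤ, (n : ℤ) = x ^ 2 + 3 * y ^ 2 + 9 * z ^ 2 + 9 ^ r * w ^ 2 := by
  rw [mem_union_progression_iff] at hn
  push Not at hn
  exact exists_eq_one_three_nine_nine_pow hr hn.1 hn.2

/-- The union of the `r + 1` progressions is not a union of fewer admissible progressions. -/
lemma not_isUnionOfAdmissible_union_progression {r t : ℕ} (ht : t < r + 1) :
    ¬ IsUnionOfAdmissible (progression 2 3 ∪
      ⋃ i ∈ Finset.Icc 1 r, progression (2 * 3 ^ (2 * i - 1)) (3 ^ (2 * i))) t := by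
  refine not_isUnionOfAdmissible (p := 3) (c := 1) (t := r + 1) Nat.prime_three ?_
    -- First terms of the progressions: at i = 0 the truncated exponent is 0, giving 2. The orders
    -- are 0, 1, 3, 5, ….
    (fun i => 2 * 3 ^ (2 * (i : ℕ) - 1)) ?_ ?_ ht
  · intro n hn hmod
    have hmod : n % 3 = 1 := hmod
    rcases mem_union_progression_iff.1 hn with h | ⟨j, -, q, rfl⟩
    · omega
    · rw [show 9 * q + 6 = 3 * (3 * q + 2) by ring, mul_left_comm] at hmod
      omega
  · rintro ⟨i, hi⟩
    rcases Nat.eq_zero_or_pos i with rfl | h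
    · exact Or.inl ⟨0, rfl⟩
    · exact Or.inr (Set.mem_biUnion (Finset.mem_coe.2 (Finset.mem_Icc.2 ⟨h, by omega⟩))
        ⟨0, rfl⟩)
  · have : Fact (Nat.Prime 3) := ⟨Nat.prime_three⟩
    have key : ∀ k, padicValNat 3 (2 * 3 ^ k) = k := fun k => by
      rw [padicValNat.mul (by norm_num) (by positivity), padicValNat.prime_pow,
        padicValNat.eq_zero_of_not_dvd (by norm_num), zero_add]
    intro i j hij
    simp only [key] at hij
    exact Fin.ext (by omega)

lemma isUnionOfAdmissible_union_progression (r : ℕ) :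
    IsUnionOfAdmissible (progression 2 3 ∪
      ⋃ i ∈ Finset.Icc 1 r, progression (2 * 3 ^ (2 * i - 1)) (3 ^ (2 * i))) (r + 1) := by
  refine ⟨Fin.cons 2 fun i => 2 * 3 ^ (2 * (i + 1 : ℕ) - 1),
    Fin.cons 3 fun i => 3 ^ (2 * (i + 1 : ℕ)), ?_, ?_⟩
  · refine Fin.cases ?_ fun i => ?_
    · exact isAdmissible_two_mul_three_pow (i := 0)
    · exact isAdmissible_two_mul_three_pow (i := 2 * (i + 1 : ℕ) - 1)
  · ext n
    rw [mem_union_progression_iff, Set.mem_iUnion, Fin.exists_fin_succ]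
    simp only [Fin.cons_zero, Fin.cons_succ, mem_progression_two_three_iff, mem_progression_iff,
      Fin.exists_iff, exists_prop]

/-! ### The lattices ⟨1, 3, 9, 9^r⟩ and ⟨1, 1, 3, 9⟩ -/

section

variable {V : Type*} [AddCommGroup V] [Module ℚ V] {Q : QuadraticForm ℚ V} {L : Submodule ℤ V}

lemma natCast_mem_valueSet_iff {a b c d : ℤ} (h : IsDiagonal Q L ![a, b, c, d]) (n : ℕ) :
    (n : ℚ) ∈ valueSet Q L ↔
      ∃ x y z w : ℤ, (n : ℤ) = a * x ^ 2 + b * y ^ 2 + c * z ^ 2 + d * w ^ 2 := by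
  rw [mem_valueSet_iff h]
  constructor
  · rintro ⟨x, hx⟩
    refine ⟨x 0, x 1, x 2, x 3, ?_⟩
    have : ((n : ℤ) : ℚ) = _ := hx
    simpa [Fin.sum_univ_four] using Int.cast_injective this
  · rintro ⟨x, y, z, w, hn⟩
    refine ⟨![x, y, z, w], ?_⟩
    rw [← Int.cast_natCast, hn]
    simp [Fin.sum_univ_four]

lemma excluded_one_three_nine_nine_pow {r : ℕ} (hr : 1 ≤ r)
    (h : IsDiagonal Q L ![1, 3, 9, 9 ^ r]) :
    excluded Q L = progression 2 3 ∪
      ⋃ i ∈ Finset.Icc 1 r, progression (2 * 3 ^ (2 * i - 1)) (3 ^ (2 * i)) := by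
  ext n
  rw [excluded, Set.mem_ofPred_eq, natCast_mem_valueSet_iff h]
  constructor
  · rintro ⟨-, hn⟩
    by_contra hmem
    obtain ⟨x, y, z, w, h⟩ := exists_of_not_mem_union_progression hr hmem
    exact hn ⟨x, y, z, w, by rw [h]; ring⟩
  · refine fun hn => ⟨Nat.pos_of_ne_zero ?_, ?_⟩
    · rintro rfl
      exact not_mem_union_progression hr (x := 0) (y := 0) (z := 0) (w := 0) (by simp) hn
    · rintro ⟨x, y, z, w, h⟩
      exact not_mem_union_progression hr (x := x) (y := y) (z := z) (w := w ^ 2)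
        (by rw [h]; ring) hn

lemma isPosDef_one_three_nine_nine_pow {r : ℕ} (h : IsDiagonal Q L ![1, 3, 9, 9 ^ r]) :
    IsPosDef Q L :=
  isPosDef_of_isDiagonal h (by simp [Fin.forall_fin_succ])

lemma isRegular_one_three_nine_nine_pow [Submodule.IsLattice ℚ L] {r : ℕ} (hr : 1 ≤ r)
    (h : IsDiagonal Q L ![1, 3, 9, 9 ^ r]) : IsRegular Q L := by
  refine ⟨isPosDef_one_three_nine_nine_pow h, Set.Subset.antisymm ?_ ?_⟩
  · intro c hc
    obtain ⟨x, hx⟩ := (mem_valueSet_iff h c).1 hc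
    exact ⟨⟨_, hx⟩, L, mem_genus_self, hc⟩
  · rintro c ⟨⟨m, rfl⟩, K, hK, hc⟩
    have hm : 0 ≤ m := by
      obtain ⟨v, -, hv⟩ := hc
      have := quadraticForm_nonneg h (by simp [Fin.forall_fin_succ]) v
      rw [hv] at this
      exact_mod_cast this
    lift m to ℕ using hm
    have : Fact (Nat.Prime 3) := ⟨Nat.prime_three⟩
    obtain ⟨x, hx⟩ := exists_padicInt_of_mem_genus h hK hc 3
    -- The precision 3^(2r) = 9^r is exactly what detects all the progressions.
    obtain ⟨y, w, hw⟩ := exists_int_dvd_sub_of_padicInt (m : ℤ) x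
      (by rw [← hx]; push_cast; rfl) (2 * r)
    have hnot := not_mem_union_progression (n := m) hr (x := y 0) (y := y 1) (z := y 2)
      (w := y 3 ^ 2 + w) (by
        rw [pow_mul] at hw
        simp [Fin.sum_univ_four] at hw
        linear_combination hw)
    obtain ⟨x, y, z, w, h'⟩ := exists_of_not_mem_union_progression hr hnot
    exact (natCast_mem_valueSet_iff h m).2 ⟨x, y, z, w, by rw [h']; ring⟩

lemma avoidsExactly_one_three_nine_nine_pow {r : ℕ} (hr : 1 ≤ r)
    (h : IsDiagonal Q L ![1, 3, 9, 9 ^ r]) : AvoidsExactly Q L (r + 1) := by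
  refine ⟨isPosDef_one_three_nine_nine_pow h, ?_, ?_⟩ <;>
    rw [excluded_one_three_nine_nine_pow hr h]
  · exact isUnionOfAdmissible_union_progression r
  · exact fun t => not_isUnionOfAdmissible_union_progression

lemma excluded_one_one_three_nine (h : IsDiagonal Q L ![1, 1, 3, 9]) :
    excluded Q L = progression 6 9 := by
  ext n
  rw [excluded, Set.mem_ofPred_eq, natCast_mem_valueSet_iff h]
  constructor
  · rintro ⟨-, hn⟩
    by_contra hmem
    obtain ⟨x, y, z, w, h⟩ := exists_eq_one_one_three_nine (n := n)
      fun h6 => hmem ⟨n / 9, by omega⟩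
    exact hn ⟨x, y, z, w, by rw [h]; ring⟩
  · rintro ⟨q, rfl⟩
    refine ⟨by omega, ?_⟩
    rintro ⟨x, y, z, w, h⟩
    refine sq_add_sq_add_three_mul_sq_add_nine_pow_mul_ne 1 0 one_pos x y z (w ^ 2) q ?_
    push_cast at h
    linear_combination -h

lemma avoidsExactly_one_one_three_nine (h : IsDiagonal Q L ![1, 1, 3, 9]) :
    AvoidsExactly Q L 1 := by
  refine ⟨isPosDef_of_isDiagonal h (by simp [Fin.forall_fin_succ]), ?_, ?_⟩ <;>
    rw [excluded_one_one_three_nine h]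
  · exact ⟨fun _ => 6, fun _ => 9, fun _ => isAdmissible_two_mul_three_pow (i := 1),
      (Set.iUnion_const _).symm⟩
  · rintro t ht ⟨a, m, -, hS⟩
    obtain rfl : t = 0 := by omega
    have h6 : 6 ∈ progression 6 9 := ⟨0, rfl⟩
    rw [hS] at h6
    simp at h6

end

/-- Every diagonal integral form is realized by a lattice on the standard space. -/
lemma exists_isLattice_isDiagonal {n : ℕ} (a : Fin n → ℤ) :
    ∃ (Q : QuadraticForm ℚ (Fin n → ℚ)) (L : Submodule ℤ (Fin n → ℚ)),
      Submodule.IsLattice ℚ L ∧ IsDiagonal Q L a := by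
  refine ⟨LinearMap.BilinMap.toQuadraticMap
      (Matrix.toBilin' (Matrix.diagonal fun i => (a i : ℚ))),
    Submodule.span ℤ (Set.range (Pi.basisFun ℚ (Fin n))), ⟨?_, ?_⟩,
    (Pi.basisFun ℚ (Fin n)).restrictScalars ℤ, ?_⟩
  · exact Submodule.fg_span (Set.finite_range _)
  · rw [Submodule.span_span_of_tower, (Pi.basisFun ℚ (Fin n)).span_eq]
  · ext i j
    simp only [Matrix.of_apply, Module.Basis.restrictScalars_apply, Pi.basisFun_apply, bilin]
    rw [QuadraticMap.associated_left_inverse]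
    · exact Matrix.toBilin'_single _ i j
    · intro x y
      simp only [Matrix.toBilin'_apply, Matrix.diagonal_apply]
      simp only [mul_ite, ite_mul, mul_zero, zero_mul, Finset.sum_ite_eq, Finset.mem_univ, if_true]
      exact Finset.sum_congr rfl fun _ _ => by ring

end QuadLattice

open QuadLattice in
theorem proposition3 :
    (∀ r : ℕ, 1 ≤ r →
      ∀ (V : Type*) [AddCommGroup V] [Module ℚ V] (Q : QuadraticForm ℚ V) (L : Submodule ℤ V),
        Submodule.IsLattice ℚ L → IsDiagonal Q L ![1, 3, 9, 9 ^ r] →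
          IsRegular Q L ∧
          excluded Q L = progression 2 3 ∪
            ⋃ i ∈ Finset.Icc 1 r, progression (2 * 3 ^ (2 * i - 1)) (3 ^ (2 * i)) ∧
          IsAdmissible 2 3 ∧
          (∀ i ∈ Finset.Icc 1 r, IsAdmissible (2 * 3 ^ (2 * i - 1)) (3 ^ (2 * i))) ∧
          AvoidsExactly Q L (r + 1)) ∧
    (∀ k : ℕ, 1 ≤ k →
      ∃ (Q : QuadraticForm ℚ (Fin 4 → ℚ)) (L : Submodule ℤ (Fin 4 → ℚ)) (a : Fin 4 → ℤ),
        Submodule.IsLattice ℚ L ∧ scale Q L = 1 ∧ IsDiagonal Q L a ∧ AvoidsExactly Q L k) := by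
  refine ⟨fun r hr V _ _ Q L hL h => ⟨isRegular_one_three_nine_nine_pow hr h,
    excluded_one_three_nine_nine_pow hr h, isAdmissible_two_mul_three_pow (i := 0),
    fun i hi => ?_, avoidsExactly_one_three_nine_nine_pow hr h⟩, fun k hk => ?_⟩
  · obtain ⟨j, rfl⟩ : ∃ j, i = j + 1 := ⟨i - 1, by have := Finset.mem_Icc.1 hi; omega⟩
    exact isAdmissible_two_mul_three_pow (i := 2 * (j + 1) - 1)
  · rcases hk.eq_or_lt with rfl | hk
    · obtain ⟨Q, L, hL, h⟩ := exists_isLattice_isDiagonal ![1, 1, 3, 9]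
      exact ⟨Q, L, _, hL, scale_eq_one h 0 rfl, h, avoidsExactly_one_one_three_nine h⟩
    · obtain ⟨r, rfl⟩ : ∃ r, k = r + 1 := ⟨k - 1, by omega⟩
      obtain ⟨Q, L, hL, h⟩ := exists_isLattice_isDiagonal ![1, 3, 9, 9 ^ r]
      exact ⟨Q, L, _, hL, scale_eq_one h 0 rfl, h,
        avoidsExactly_one_three_nine_nine_pow (by omega) h⟩
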